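/- For $m$ items, a score vector $s\in\mathbb R^m$ and a nondecreasing, strictly positive function $\phi:\mathbb R\to\mathbb R$, let $$P_s(\pi)=\prod_{j=1}^m \frac{\phi(s_{\pi_j})}{\sum_{l=j}^m \phi(s_{\pi_l})},\qquad \pi\in S_m,$$ be the permutation probability. Let $\mathcal X$ be a set of real $n\times m$ score matrices with rows $X_i$, let $X^\star\in\mathcal X$, and let $\Pi_1,\dots,\Pi_n$ be independent random permutations with $\Pi_i\sim P_{X^\star_i}$. Let $\hat X$ be a constrained maximum likelihood estimator: almost surely $\hat X\in\mathcal X$ and $\hat X$ minimizes $X\mapsto-\log\prod_{i=1}^n P_{X_i}(\Pi_i)$ over $\mathcal X$. Let $$D(X^\star,X)=\frac1n\sum_{i=1}^n\sum_{\pi\in S_m}P_{X^\star_i}(\pi)\log\frac{P_{X^\star_i}(\pi)}{P_{X_i}(\pi)}$$ be the averaged Kullback–Leibler divergence (the expectation is over $\pi\sim P_{X^\star_i}$ with $X$ held fixed; then $X=\hat X$ is inserted). Let $\mathcal Z=\{\log\phi(X):X\in\mathcal X\}$ with $\log\phi$ applied elementwise, let $\|Z\|_{\infty,2}=\big(\sum_{i=1}^n\max_j|Z_{ij}|^2\big)^{1/2}$,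 let $\mathcal N(u,\mathcal Z,\|\cdot\|_{\infty,2})$ be the least number of balls of radius $u$ in this norm needed to cover $\mathcal Z$, and let $$g(\mathcal Z)=\int_0^\infty\sqrt{\ln\mathcal N(u,\mathcal Z,\|\cdot\|_{\infty,2})}\,du .$$ Suppose that $|Z_{ij}|\le C$ for all $Z\in\mathcal Z$ and all $i,j$. Then $$D(X^\star,\hat X)=O_{\mathbb P}\Big(\frac{\sqrt m\,\ln m}{n}\,g(\mathcal Z)\Big),$$ where the $O_{\mathbb P}$ hides only a dependence on $C$. That is, for every $C$ and every $\varepsilon>0$ there is a constant $K>0$, depending only on $C$ and $\varepsilon$, such that for all $n,m\ge1$ and all $\phi,\mathcal X,X^\star,\hat X$ as above, $$\mathbb P\Big\{D(X^\star,\hat X)>K\,\frac{\sqrt m\,\ln m}{n}\,g(\mathcal Z)\Big\}\le\varepsilon .$$ -/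

import Mathlib

open MeasureTheory ProbabilityTheory Set
open scoped ENNReal

noncomputable section

/-- Rankings of `m` items form a finite set and carry the discrete σ-algebra. A ranking is a
permutation `π`, where `π j` is the item in position `j` (position `0` is the top). -/
instance rankingMeasurableSpace (m : ℕ) : MeasurableSpace (Equiv.Perm (Fin m)) := ⊤

/-- The permutation probability
`P_s(π) = ∏ⱼ φ(s_{π j}) / ∑_{l ≥ j} φ(s_{π l})` for a score vector `s`. -/
def permProb {m : ℕ} (φ : ℝ → ℝ) (s : Fin m → ℝ) (π : Equiv.Perm (Fin m)) : ℝ :=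
  ∏ j, φ (s (π j)) / ∑ l ∈ Finset.Ici j, φ (s (π l))

/-- The listwise negative log-likelihood `-log P_X(p)` of a score matrix `X` (users are rows,
items are columns), given the rankings `p 1, …, p n` of the users;
`P_X(p) = ∏ᵢ P_{X i}(p i)`. -/
def negLogLik {n m : ℕ} (φ : ℝ → ℝ) (p : Fin n → Equiv.Perm (Fin m))
    (X : Matrix (Fin n) (Fin m) ℝ) : ℝ :=
  -Real.log (∏ i, permProb φ (X i) (p i))

/-- The averaged Kullback–Leibler divergence
`D(X⋆, X) = (1/n) ∑ᵢ 𝔼 log (P_{X⋆ i}(π) / P_{X i}(π))`, the expectation being over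
`π ∼ P_{X⋆ i}` with `X` held fixed. -/
def avgKL {n m : ℕ} (φ : ℝ → ℝ) (Xstar X : Matrix (Fin n) (Fin m) ℝ) : ℝ :=
  (1 / (n : ℝ)) * ∑ i, ∑ π : Equiv.Perm (Fin m),
    permProb φ (Xstar i) π * Real.log (permProb φ (Xstar i) π / permProb φ (X i) π)

/-- `n × m` real matrices with the norm `‖Z‖_{∞,2} = √(∑ᵢ ‖Zᵢ‖_∞²)`: the `ℓ²` sum over the rows
of the sup norms of the rows. -/
abbrev InfTwoMatrix (n m : ℕ) : Type := PiLp 2 (fun _ : Fin n => Fin m → ℝ)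

theorem infTwoMatrix_norm_eq {n m : ℕ} (Z : InfTwoMatrix n m) :
    ‖Z‖ = √(∑ i, (⨆ j, |Z i j|) ^ 2) := by
  have h : ∀ v : Fin m → ℝ, ‖v‖ = ⨆ j, |v j| := by
    intro v
    refine le_antisymm ?_ ?_
    · refine (pi_norm_le_iff_of_nonneg (Real.iSup_nonneg fun j => abs_nonneg _)).2 fun j => ?_
      exact le_ciSup (f := fun j => |v j|) (Set.finite_range _).bddAbove j
    · exact Real.iSup_le (fun j => norm_le_pi_norm v j) (norm_nonneg _)
  rw [PiLp.norm_eq_of_L2]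
  simp only [h]

/-- The set `𝒵 = {log φ(X) : X ∈ 𝒳}`, with `log φ` applied elementwise, in the space of matrices
with the `∞,2` norm. -/
def logScores {n m : ℕ} (φ : ℝ → ℝ) (𝒳 : Set (Matrix (Fin n) (Fin m) ℝ)) :
    Set (InfTwoMatrix n m) :=
  (fun X => WithLp.toLp 2 fun i j => Real.log (φ (X i j))) '' 𝒳

/-- Dudley's entropy integral `∫₀^∞ √(ln 𝒩(u, S)) du`, where `𝒩(u, S)` is the least number of
balls of radius `u` needed to cover `S`. The integral is taken in `[0, ∞]`. -/
def entropyIntegral {E : Type*} [PseudoEMetricSpace E] (S : Set E) : ℝ≥0∞ :=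
  ∫⁻ u in Ioi (0 : ℝ),
    (ENNReal.log ((Metric.externalCoveringNumber u.toNNReal S : ℕ∞) : ℝ≥0∞)).toENNReal
      ^ (1 / 2 : ℝ)

end

/-! Put `Z = log φ(X)`. Since the estimator beats the truth in likelihood, `n * D(X⋆, X̂)` is at
most the increment, from the true log-scores to the estimated ones, of the centred log-likelihood
(`mul_avgKL_le`). It remains to bound this process over `𝒵` in mean and apply Markov's inequality.
Dudley's chaining (`dudley_selection`) bounds the mean once the increments are sub-Gaussian at scale
`√m log m` times the `∞,2` distance.

That scale is the heart of the matter. In one row, the log-likelihood difference of `z` and `z'` is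
a deterministic term plus `∑ G(S_j)`, where `S_j` is the set of items still unranked at position `j`
and `G` is the difference of the two log-sum-exps. A ranking draws items without replacement, so
this sum has a Doob martingale. Altering one draw exchanges a single item of the remaining urn. Such
an exchange in an urn of `t + 1` items moves `G` by `O(δ / (t + 1))`, where `δ` bounds `|z - z'|`
(`logSumExp_exchange_le`), and a coupling shows that the two urns keep differing by at most one item
(`seqMean_exchange`). Martingale differences are therefore `O(δ ∑ 1 / (t + 1)) = O(δ log m)`, and
`m` of them give the variance proxy `O(m (log m)² δ²)` (`plLog_mgf_le`). Rows are independent, so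
their proxies add up to the squared `∞,2` distance.

Rankings form a finite set, so all expectations are finite sums. A supremum over `𝒵` is replaced by
the process at a point selected from the ranking, so no measurability of suprema or of the estimator
is needed. -/

/-! ### Sampling without replacement, one item at a time -/

/-- The sum over all orderings `a₁, …, a_k` of a `k`-element set `S` of
`∏ⱼ ψ aⱼ {aⱼ, …, a_k}`, computed by conditioning on the first item. -/
def seqSum {α : Type*} [DecidableEq α] (ψ : α → Finset α → ℝ) : ℕ → Finset α → ℝ
  | 0, _ => 1
  | k + 1, S => ∑ a ∈ S, ψ a S * seqSum ψ k (S.erase a)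

/-- The mean of `∑ⱼ G {aⱼ, …, a_k}` when the next item `a` is drawn from the remaining set `S`
with probability `p a S`. -/
def seqMean {α : Type*} [DecidableEq α] (p : α → Finset α → ℝ) (G : Finset α → ℝ) :
    ℕ → Finset α → ℝ
  | 0, _ => 0
  | k + 1, S => G S + ∑ a ∈ S, p a S * seqMean p G k (S.erase a)

/-- Orderings are written as injective maps with image `S` rather than as permutations, so that
removing the first item leaves an object of the same kind on `S.erase a` and the induction closes.
-/
theorem sum_orderings_eq_seqSum {α : Type*} [DecidableEq α] [Fintype α]
    (ψ : α → Finset α → ℝ) (k : ℕ) (S : Finset α) (hS : S.card = k) :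
    (∑ f : Fin k → α, if Function.Injective f ∧ Finset.univ.image f = S then
      ∏ j, ψ (f j) ((Finset.Ici j).image f) else 0) = seqSum ψ k S := by
  induction k generalizing S with
  | zero =>
    rw [Finset.card_eq_zero] at hS
    subst hS
    simp [seqSum, Function.injective_of_subsingleton]
  | succ k ih =>
    have key : ∀ (a : α) (g : Fin k → α),
        (if Function.Injective (Fin.cons a g : Fin (k + 1) → α) ∧
            Finset.univ.image (Fin.cons a g : Fin (k + 1) → α) = S then
          ∏ j, ψ ((Fin.cons a g : Fin (k + 1) → α) j)
            ((Finset.Ici j).image (Fin.cons a g : Fin (k + 1) → α)) else 0)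
        = if a ∈ S then ψ a S * (if Function.Injective g ∧ Finset.univ.image g = S.erase a then
            ∏ j, ψ (g j) ((Finset.Ici j).image g) else 0) else 0 := by
      intro a g
      have him : Finset.univ.image (Fin.cons a g : Fin (k + 1) → α)
          = insert a (Finset.univ.image g) := by
        ext x
        simp [Fin.exists_fin_succ, eq_comm]
      have hiff : (Function.Injective (Fin.cons a g : Fin (k + 1) → α) ∧
            Finset.univ.image (Fin.cons a g : Fin (k + 1) → α) = S) ↔
          a ∈ S ∧ Function.Injective g ∧ Finset.univ.image g = S.erase a := by
        rw [him, Fin.cons_injective_iff]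
        constructor
        · rintro ⟨⟨h1, h2⟩, rfl⟩
          have : a ∉ Finset.univ.image g := by simpa using h1
          exact ⟨Finset.mem_insert_self _ _, h2, (Finset.erase_insert this).symm⟩
        · rintro ⟨h1, h2, h3⟩
          refine ⟨⟨?_, h2⟩, ?_⟩
          · have : a ∉ Finset.univ.image g := by rw [h3]; simp
            simpa using this
          · rw [h3, Finset.insert_erase h1]
      by_cases h : a ∈ S ∧ Function.Injective g ∧ Finset.univ.image g = S.erase a
      · rw [if_pos (hiff.2 h), if_pos h.1, if_pos h.2, Fin.prod_univ_succ]
        congr 1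
        · rw [show (Finset.Ici (0 : Fin (k + 1))) = Finset.univ by ext; simp, (hiff.2 h).2]
          simp
        · refine Finset.prod_congr rfl fun j _ => ?_
          rw [Fin.cons_succ]
          congr 1
          ext x
          simp only [Finset.mem_image, Finset.mem_Ici]
          constructor
          · rintro ⟨i, hi, rfl⟩
            cases i using Fin.cases with
            | zero => simp at hi
            | succ i => exact ⟨i, by simpa using hi, by simp⟩
          · rintro ⟨i, hi, rfl⟩
            exact ⟨i.succ, by simpa using hi, by simp⟩
      · rw [if_neg (mt hiff.1 h)]
        by_cases ha : a ∈ S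
        · rw [if_pos ha, if_neg (fun h' => h ⟨ha, h'⟩), mul_zero]
        · rw [if_neg ha]
    rw [← (Fin.consEquiv fun _ : Fin (k + 1) => α).sum_comp, Fintype.sum_prod_type]
    refine (Finset.sum_congr rfl fun a _ => Finset.sum_congr rfl fun g _ => key a g).trans ?_
    rw [seqSum, ← Finset.sum_filter_add_sum_filter_not Finset.univ (· ∈ S)]
    rw [Finset.sum_congr rfl (g := fun a => ψ a S * seqSum ψ k (S.erase a)),
      Finset.sum_eq_zero (s := Finset.univ.filter fun a => a ∉ S), add_zero]
    · simp
    · intro a ha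
      simp [(Finset.mem_filter.1 ha).2]
    · intro a ha
      have ha := (Finset.mem_filter.1 ha).2
      simp only [ha, if_true]
      rw [← Finset.mul_sum, ih (S.erase a) (by rw [Finset.card_erase_of_mem ha, hS]; rfl)]

theorem sum_perm_eq_seqSum {m : ℕ} (ψ : Fin m → Finset (Fin m) → ℝ) :
    ∑ π : Equiv.Perm (Fin m), ∏ j, ψ (π j) ((Finset.Ici j).image π)
      = seqSum ψ m Finset.univ := by
  rw [← sum_orderings_eq_seqSum ψ m Finset.univ (by simp), ← Finset.sum_filter]
  refine Finset.sum_bij (fun π _ => (π : Fin m → Fin m)) ?_ ?_ ?_ ?_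
  · intro π _
    simp [π.injective, Finset.image_univ_of_surjective π.surjective]
  · intro π _ ρ _ h
    exact DFunLike.coe_injective h
  · intro f hf
    have := (Finset.mem_filter.1 hf).2.1
    exact ⟨Equiv.ofBijective f (Finite.injective_iff_bijective.1 this), Finset.mem_univ _, rfl⟩
  · intro π _
    rfl

/-- The probability of drawing `a` from `S` when the items have weights `w`. -/
noncomputable def drawProb {α : Type*} (w : α → ℝ) (a : α) (S : Finset α) : ℝ :=
  w a / ∑ x ∈ S, w x

/-! ### Urn draws: exchange of one item and exponential moments -/

section draw

variable {α : Type*} {w : α → ℝ}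

theorem drawProb_nonneg (hw : ∀ a, 0 < w a) (a : α) (S : Finset α) : 0 ≤ drawProb w a S :=
  div_nonneg (hw a).le (Finset.sum_nonneg fun x _ => (hw x).le)

theorem sum_drawProb (hw : ∀ a, 0 < w a) {S : Finset α} (hS : S.Nonempty) :
    ∑ a ∈ S, drawProb w a S = 1 := by
  simp only [drawProb]
  rw [← Finset.sum_div, div_self (Finset.sum_pos (fun x _ => hw x) hS).ne']

variable [DecidableEq α]

/-- A coupling of the first draws. The urn with the heavier item `x` gives every `a ∈ T` a smaller
probability `p a ≤ p' a`. With mass `p a` both urns draw `a`, and the remainders differ by `x`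
against `y`; with the excess mass `p' a - p a` the first urn draws `x` and the second `a`, and the
remainders differ by `a` against `y`; otherwise the urns draw `x` and `y` and both leave `T`. The
total mass of remainders that differ is at most one, so `B` is not amplified, whatever the weights.
-/
theorem seqMean_exchange_of_le (hw : ∀ a, 0 < w a) {G : Finset α → ℝ} {b B : ℝ} (t : ℕ)
    (hB : ∀ T : Finset α, T.card = t → ∀ x ∉ T, ∀ y ∉ T,
      |G (insert x T) - G (insert y T)| ≤ b)
    (hM : 0 ≤ B) (h : ∀ T : Finset α, T.card + 1 = t → ∀ x ∉ T, ∀ y ∉ T,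
      |seqMean (drawProb w) G t (insert x T) - seqMean (drawProb w) G t (insert y T)| ≤ B)
    (T : Finset α) (hT : T.card = t) (x y : α) (hx : x ∉ T) (hy : y ∉ T) (hxy : w y ≤ w x) :
    |seqMean (drawProb w) G (t + 1) (insert x T) - seqMean (drawProb w) G (t + 1) (insert y T)|
      ≤ b + B := by
  set M := seqMean (drawProb w) G t with hMdef
  set p := fun a => drawProb w a (insert x T)
  set p' := fun a => drawProb w a (insert y T)
  have hpp : ∀ a, p a ≤ p' a := by
    intro a
    refine div_le_div_of_nonneg_left (hw a).le ?_ ?_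
    · exact Finset.sum_pos (fun x _ => hw x) (Finset.insert_nonempty _ _)
    · rw [Finset.sum_insert hx, Finset.sum_insert hy]
      linarith
  have e1 : p x + ∑ a ∈ T, p a = 1 := by
    rw [← sum_drawProb hw (Finset.insert_nonempty x T), Finset.sum_insert hx]
  have e2 : p' y + ∑ a ∈ T, p' a = 1 := by
    rw [← sum_drawProb hw (Finset.insert_nonempty y T), Finset.sum_insert hy]
  have hp0 : ∀ a, 0 ≤ p a := fun a => drawProb_nonneg hw _ _
  have hp0' : ∀ a, 0 ≤ p' a := fun a => drawProb_nonneg hw _ _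
  have r1 : seqMean (drawProb w) G (t + 1) (insert x T)
      = G (insert x T) + (p x * M T + ∑ a ∈ T, p a * M ((insert x T).erase a)) := by
    rw [seqMean, Finset.sum_insert hx, Finset.erase_insert hx]
  have r2 : seqMean (drawProb w) G (t + 1) (insert y T)
      = G (insert y T) + (p' y * M T + ∑ a ∈ T, p' a * M ((insert y T).erase a)) := by
    rw [seqMean, Finset.sum_insert hy, Finset.erase_insert hy]
  -- The three cases of the coupling; the last one cancels, since both remainders are `T`.
  have e3 : seqMean (drawProb w) G (t + 1) (insert x T)
        - seqMean (drawProb w) G (t + 1) (insert y T)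
      = (G (insert x T) - G (insert y T))
        + ∑ a ∈ T, (p a * (M ((insert x T).erase a) - M ((insert y T).erase a))
          + (p' a - p a) * (M T - M ((insert y T).erase a))) := by
    have : ∑ a ∈ T, (p a * (M ((insert x T).erase a) - M ((insert y T).erase a))
          + (p' a - p a) * (M T - M ((insert y T).erase a)))
        = ∑ a ∈ T, p a * M ((insert x T).erase a) - ∑ a ∈ T, p' a * M ((insert y T).erase a)
          + (∑ a ∈ T, p' a - ∑ a ∈ T, p a) * M T := by
      rw [← Finset.sum_sub_distrib, ← Finset.sum_sub_distrib, Finset.sum_mul,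
        ← Finset.sum_add_distrib]
      refine Finset.sum_congr rfl fun a _ => ?_
      ring
    rw [this, r1, r2]
    have : ∑ a ∈ T, p' a - ∑ a ∈ T, p a = p x - p' y := by linarith
    rw [this]
    ring
  rw [e3]
  have s1 : |∑ a ∈ T, (p a * (M ((insert x T).erase a) - M ((insert y T).erase a))
          + (p' a - p a) * (M T - M ((insert y T).erase a)))| ≤ ∑ a ∈ T, p' a * B := by
    refine (Finset.abs_sum_le_sum_abs _ _).trans (Finset.sum_le_sum fun a ha => ?_)
    have hxa : x ≠ a := fun h => hx (h ▸ ha)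
    have hya : y ≠ a := fun h => hy (h ▸ ha)
    rw [Finset.erase_insert_of_ne hxa, Finset.erase_insert_of_ne hya]
    have hcard : (T.erase a).card + 1 = t := by rw [Finset.card_erase_add_one ha, hT]
    have hx' : x ∉ T.erase a := fun h => hx (Finset.mem_of_mem_erase h)
    have hy' : y ∉ T.erase a := fun h => hy (Finset.mem_of_mem_erase h)
    have b1 := h _ hcard x hx' y hy'
    have b2 := h _ hcard a (Finset.notMem_erase a T) y hy'
    rw [Finset.insert_erase ha] at b2
    refine (abs_add_le _ _).trans ?_
    rw [abs_mul, abs_mul, abs_of_nonneg (hp0 a), abs_of_nonneg (sub_nonneg.2 (hpp a))]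
    have := mul_le_mul_of_nonneg_left b1 (hp0 a)
    have := mul_le_mul_of_nonneg_left b2 (sub_nonneg.2 (hpp a))
    linarith
  have s2 : ∑ a ∈ T, p' a * B ≤ B := by
    rw [← Finset.sum_mul]
    have : ∑ a ∈ T, p' a ≤ 1 := by linarith [hp0' y]
    nlinarith
  exact (abs_add_le _ _).trans (add_le_add (hB T hT x hx y hy) (s1.trans s2))

/-- Two urns that differ in one item have nearly the same mean. -/
theorem seqMean_exchange (hw : ∀ a, 0 < w a) {G : Finset α → ℝ} {b : ℕ → ℝ} (hb : ∀ t, 0 ≤ b t)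
    (hG : ∀ T : Finset α, ∀ x ∉ T, ∀ y ∉ T,
      |G (insert x T) - G (insert y T)| ≤ b T.card) (t : ℕ) :
    ∀ T : Finset α, T.card + 1 = t → ∀ x ∉ T, ∀ y ∉ T,
      |seqMean (drawProb w) G t (insert x T) - seqMean (drawProb w) G t (insert y T)|
        ≤ ∑ i ∈ Finset.range t, b i := by
  induction t with
  | zero => intro T hT; omega
  | succ t ih =>
    intro T hT x hx y hy
    have hT : T.card = t := by omega
    rw [Finset.sum_range_succ, add_comm (∑ i ∈ Finset.range t, b i)]
    have hGt : ∀ T : Finset α, T.card = t → ∀ x ∉ T, ∀ y ∉ T,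
        |G (insert x T) - G (insert y T)| ≤ b t := fun T hT => hT ▸ hG T
    have hs : 0 ≤ ∑ i ∈ Finset.range t, b i := Finset.sum_nonneg fun i _ => hb i
    rcases le_total (w y) (w x) with h | h
    · exact seqMean_exchange_of_le hw t hGt hs ih T hT x y hx hy h
    · rw [abs_sub_comm]
      exact seqMean_exchange_of_le hw t hGt hs ih T hT y x hy hx h

theorem exp_le_add_exp_sq (x : ℝ) : Real.exp x ≤ x + Real.exp (x ^ 2) := by
  have h2 := Real.add_one_le_exp (x ^ 2)
  rcases le_or_gt |x| 1 with h | h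
  · have := (abs_le.1 (Real.abs_exp_sub_one_sub_id_le h)).2
    linarith
  · rcases lt_abs.1 h with h | h
    · have : Real.exp x ≤ Real.exp (x ^ 2) := Real.exp_le_exp.2 (by nlinarith)
      linarith
    · have : Real.exp x ≤ 1 := Real.exp_le_one_iff.2 (by linarith)
      nlinarith

/-- Hoeffding's lemma with a cruder constant: after centring, the linear term of `exp_le_add_exp_sq`
averages to zero, and no value is further than `B` from an average of the values. -/
theorem sum_mul_exp_le {ι : Type*} (s : Finset ι) (p y : ι → ℝ) (hp : ∀ i ∈ s, 0 ≤ p i)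
    (h1 : ∑ i ∈ s, p i = 1) {B : ℝ} (hy : ∀ i ∈ s, ∀ j ∈ s, |y i - y j| ≤ B) (l : ℝ) :
    ∑ i ∈ s, p i * Real.exp (l * y i)
      ≤ Real.exp (l * ∑ i ∈ s, p i * y i + l ^ 2 * B ^ 2) := by
  set μ := ∑ i ∈ s, p i * y i with hμ
  have hdev : ∀ i ∈ s, |y i - μ| ≤ B := by
    intro i hi
    have : y i - μ = ∑ j ∈ s, p j * (y i - y j) := by
      simp only [mul_sub, Finset.sum_sub_distrib, ← Finset.sum_mul, h1, one_mul, hμ]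
    rw [this]
    refine (Finset.abs_sum_le_sum_abs _ _).trans ?_
    calc _ ≤ ∑ j ∈ s, p j * B := Finset.sum_le_sum fun j hj => by
            rw [abs_mul, abs_of_nonneg (hp j hj)]
            exact mul_le_mul_of_nonneg_left (hy i hi j hj) (hp j hj)
      _ = B := by rw [← Finset.sum_mul, h1, one_mul]
  calc ∑ i ∈ s, p i * Real.exp (l * y i)
      ≤ ∑ i ∈ s, p i * (Real.exp (l * μ) * (l * (y i - μ) + Real.exp (l ^ 2 * B ^ 2))) := by
        refine Finset.sum_le_sum fun i hi => mul_le_mul_of_nonneg_left ?_ (hp i hi)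
        have : l * y i = l * μ + l * (y i - μ) := by ring
        rw [this, Real.exp_add]
        refine mul_le_mul_of_nonneg_left ((exp_le_add_exp_sq _).trans ?_) (Real.exp_pos _).le
        have h3 : (y i - μ) ^ 2 ≤ B ^ 2 := sq_le_sq' (by linarith [(abs_le.1 (hdev i hi)).1])
          (abs_le.1 (hdev i hi)).2
        have : Real.exp ((l * (y i - μ)) ^ 2) ≤ Real.exp (l ^ 2 * B ^ 2) := by
          rw [mul_pow]
          exact Real.exp_le_exp.2 (mul_le_mul_of_nonneg_left h3 (sq_nonneg l))
        linarith
    _ = Real.exp (l * μ) * (l * (μ - μ * ∑ i ∈ s, p i)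
          + Real.exp (l ^ 2 * B ^ 2) * ∑ i ∈ s, p i) := by
        have : μ - μ * ∑ i ∈ s, p i = ∑ i ∈ s, p i * (y i - μ) := by
          simp only [mul_sub, Finset.sum_sub_distrib, ← Finset.sum_mul, ← hμ]
          ring
        clear_value μ
        rw [this, Finset.mul_sum, Finset.mul_sum, ← Finset.sum_add_distrib, Finset.mul_sum]
        refine Finset.sum_congr rfl fun i _ => ?_
        ring
    _ = _ := by rw [h1, Real.exp_add]; ring

/-- The Azuma–Hoeffding argument: conditionally on the past, the mean of what follows has
oscillation at most `B` in the next draw, so each draw costs a factor `exp (l² B²)`. -/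
theorem seqSum_exp_le (hw : ∀ a, 0 < w a) {G : Finset α → ℝ} {B : ℝ} {m : ℕ}
    (hB : ∀ t ≤ m, ∀ T : Finset α, T.card + 1 = t → ∀ x ∉ T, ∀ y ∉ T,
      |seqMean (drawProb w) G t (insert x T) - seqMean (drawProb w) G t (insert y T)| ≤ B)
    (l : ℝ) (k : ℕ) (hk : k ≤ m) (S : Finset α) (hS : S.card = k) :
    seqSum (fun a S => drawProb w a S * Real.exp (l * G S)) k S
      ≤ Real.exp (l * seqMean (drawProb w) G k S + k * (l ^ 2 * B ^ 2)) := by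
  induction k generalizing S with
  | zero => simp [seqSum, seqMean]
  | succ k ih =>
    have hne : S.Nonempty := Finset.card_pos.1 (by omega)
    have hmain := sum_mul_exp_le S (fun a => drawProb w a S)
      (fun a => seqMean (drawProb w) G k (S.erase a)) (fun a _ => drawProb_nonneg hw a S)
      (sum_drawProb hw hne) (B := B) (by
        intro a ha c hc
        rcases eq_or_ne a c with rfl | hac
        · rw [sub_self, abs_zero]
          -- Exchanging an item with itself yields `0 ≤ B`.
          have := hB (k + 1) hk (S.erase a)
            (by rw [Finset.card_erase_add_one ha, hS]) a (Finset.notMem_erase _ _) a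
            (Finset.notMem_erase _ _)
          rwa [sub_self, abs_zero] at this
        -- After drawing `a` or `c` the remainders are `S \ {a, c}` plus `c` or plus `a`: one
        -- exchange.
        · have hc' : c ∈ S.erase a := Finset.mem_erase.2 ⟨hac.symm, hc⟩
          have ha' : a ∈ S.erase c := Finset.mem_erase.2 ⟨hac, ha⟩
          have hcard : ((S.erase a).erase c).card + 1 = k := by
            rw [Finset.card_erase_add_one hc', Finset.card_erase_of_mem ha, hS]; rfl
          have := hB k (by omega) ((S.erase a).erase c) hcard c (Finset.notMem_erase _ _) a
            (by simp)
          rw [Finset.insert_erase hc'] at this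
          rwa [Finset.erase_right_comm, Finset.insert_erase ha'] at this) l
    calc seqSum (fun a S => drawProb w a S * Real.exp (l * G S)) (k + 1) S
        = ∑ a ∈ S, drawProb w a S * Real.exp (l * G S) *
            seqSum (fun a S => drawProb w a S * Real.exp (l * G S)) k (S.erase a) := rfl
      _ ≤ ∑ a ∈ S, drawProb w a S * Real.exp (l * G S) *
            Real.exp (l * seqMean (drawProb w) G k (S.erase a) + k * (l ^ 2 * B ^ 2)) := by
          refine Finset.sum_le_sum fun a ha => mul_le_mul_of_nonneg_left ?_
            (mul_nonneg (drawProb_nonneg hw a S) (Real.exp_pos _).le)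
          exact ih (by omega) _ (by rw [Finset.card_erase_of_mem ha, hS]; rfl)
      _ = Real.exp (l * G S + k * (l ^ 2 * B ^ 2)) * ∑ a ∈ S, drawProb w a S *
            Real.exp (l * seqMean (drawProb w) G k (S.erase a)) := by
          rw [Finset.mul_sum]
          refine Finset.sum_congr rfl fun a _ => ?_
          rw [Real.exp_add, Real.exp_add]
          ring
      _ ≤ Real.exp (l * G S + k * (l ^ 2 * B ^ 2)) * _ :=
          mul_le_mul_of_nonneg_left hmain (Real.exp_pos _).le
      _ = _ := by
          rw [← Real.exp_add, seqMean]
          push_cast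
          ring_nf

end draw

/-- A bound `E exp (l (X - a)) ≤ exp (v l²)` for all `l` forces `E X = a`. -/
theorem mean_eq_of_mgf_le {ι : Type*} (s : Finset ι) (p X : ι → ℝ) (hp : ∀ i ∈ s, 0 ≤ p i)
    (h1 : ∑ i ∈ s, p i = 1) (a : ℝ) {v : ℝ} (hv : 0 ≤ v)
    (h : ∀ l : ℝ, ∑ i ∈ s, p i * Real.exp (l * X i) ≤ Real.exp (l * a + v * l ^ 2)) :
    ∑ i ∈ s, p i * X i = a := by
  set μ := ∑ i ∈ s, p i * X i with hμ
  have key : ∀ l : ℝ, l * (μ - a) ≤ v * l ^ 2 := by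
    intro l
    have hj := convexOn_exp.map_sum_le (t := s) (w := p) (p := fun i => l * X i) hp h1
      (fun _ _ => Set.mem_univ _)
    simp only [smul_eq_mul] at hj
    have e : ∑ i ∈ s, p i * (l * X i) = l * μ := by
      rw [hμ, Finset.mul_sum]
      exact Finset.sum_congr rfl fun i _ => by ring
    rw [e] at hj
    have := Real.exp_le_exp.1 (hj.trans (h l))
    linarith
  by_contra hne
  have hd : μ - a ≠ 0 := sub_ne_zero.2 hne
  -- Small enough for the quadratic term to lose to the linear one, and of the sign of `μ - a`.
  have h2 := key ((μ - a) / (2 * (v + 1)))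
  have hv1 : 0 < v + 1 := by linarith
  have hsq : 0 < (μ - a) ^ 2 := by positivity
  rw [div_pow, div_mul_eq_mul_div, ← sq, mul_div_assoc', div_le_div_iff₀ (by positivity)
    (by positivity)] at h2
  have : (μ - a) ^ 2 * ((v + 1) * (2 * v + 4)) ≤ 0 := by nlinarith
  have : 0 < (μ - a) ^ 2 * ((v + 1) * (2 * v + 4)) := by positivity
  linarith

/-! ### Chaining -/

/-- The Chernoff optimisation: `l = x / (2 b²)` is optimal if `b > 0`; if `b = 0`, any `l` with `l *
x > a` contradicts `x > 0`. -/
theorem le_two_mul_sqrt_of_forall {x a b : ℝ} (ha : 0 ≤ a) (hb : 0 ≤ b)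
    (h : ∀ l : ℝ, 0 < l → l * x ≤ a + l ^ 2 * b ^ 2) : x ≤ 2 * b * √a := by
  by_contra! hx
  have hx0 : 0 < x := lt_of_le_of_lt (by positivity) hx
  rcases hb.eq_or_lt with rfl | hb
  · have := h ((a + 1) / x) (by positivity)
    rw [div_mul_cancel₀ _ hx0.ne'] at this
    linarith
  · have h1 := h (x / (2 * b ^ 2)) (by positivity)
    have h2 : (2 * b * √a) ^ 2 < x ^ 2 := pow_lt_pow_left₀ hx (by positivity) two_ne_zero
    rw [mul_pow, Real.sq_sqrt ha] at h2
    have e1 : x / (2 * b ^ 2) * x = 2 * (x ^ 2 / (4 * b ^ 2)) := by field_simp; norm_num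
    have e2 : (x / (2 * b ^ 2)) ^ 2 * b ^ 2 = x ^ 2 / (4 * b ^ 2) := by field_simp; norm_num
    rw [e1, e2] at h1
    have h3 : x ^ 2 / (4 * b ^ 2) ≤ a := by linarith
    rw [div_le_iff₀ (by positivity)] at h3
    nlinarith

/-- The maximal inequality: the mean of a random choice from finitely many sub-Gaussian
variables. -/
theorem sum_selection_le {Θ ι : Type*} [Fintype Θ] (q : Θ → ℝ) (hq : ∀ r, 0 ≤ q r)
    (h1 : ∑ r, q r = 1) (V : ι → Θ → ℝ) (I : Finset ι) {b : ℝ} (hb : 0 ≤ b)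
    (hV : ∀ i ∈ I, ∀ l : ℝ, ∑ r, q r * Real.exp (l * V i r) ≤ Real.exp (l ^ 2 * b ^ 2))
    (c : Θ → ι) (hc : ∀ r, c r ∈ I) {N : ℝ} (hN : (I.card : ℝ) ≤ N) :
    ∑ r, q r * V (c r) r ≤ 2 * b * √(Real.log N) := by
  have hΘ : Nonempty Θ := by
    by_contra h
    rw [not_nonempty_iff] at h
    simp at h1
  have hI : 0 < I.card := Finset.card_pos.2 ⟨_, hc hΘ.some⟩
  have hN1 : (1 : ℝ) ≤ N := le_trans (by exact_mod_cast hI) hN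
  refine le_two_mul_sqrt_of_forall (Real.log_nonneg hN1) hb fun l _ => ?_
  have hj := convexOn_exp.map_sum_le (t := Finset.univ) (w := q) (p := fun r => l * V (c r) r)
    (fun r _ => hq r) h1 (fun _ _ => Set.mem_univ _)
  simp only [smul_eq_mul] at hj
  have e : ∑ r, q r * (l * V (c r) r) = l * ∑ r, q r * V (c r) r := by
    rw [Finset.mul_sum]
    exact Finset.sum_congr rfl fun i _ => by ring
  rw [e] at hj
  -- Union bound: the exponential at the selected index is at most the sum over all indices.
  have h2 : ∑ r, q r * Real.exp (l * V (c r) r) ≤ N * Real.exp (l ^ 2 * b ^ 2) := by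
    calc _ ≤ ∑ r, ∑ i ∈ I, q r * Real.exp (l * V i r) :=
          Finset.sum_le_sum fun r _ => Finset.single_le_sum
            (f := fun i => q r * Real.exp (l * V i r))
            (fun i _ => mul_nonneg (hq r) (Real.exp_pos _).le) (hc r)
      _ = ∑ i ∈ I, ∑ r, q r * Real.exp (l * V i r) := Finset.sum_comm
      _ ≤ ∑ i ∈ I, Real.exp (l ^ 2 * b ^ 2) := Finset.sum_le_sum fun i hi => hV i hi l
      _ = I.card * Real.exp (l ^ 2 * b ^ 2) := by simp
      _ ≤ _ := mul_le_mul_of_nonneg_right hN (Real.exp_pos _).le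
  rw [← Real.exp_log (show 0 < N by linarith), ← Real.exp_add] at h2
  exact Real.exp_le_exp.1 (hj.trans h2)

/-- The integrand of the entropy integral. -/
noncomputable def entropyRoot {E : Type*} [PseudoEMetricSpace E] (S : Set E) (u : ℝ) : ℝ≥0∞ :=
  (ENNReal.log ((Metric.externalCoveringNumber u.toNNReal S : ℕ∞) : ℝ≥0∞)).toENNReal
      ^ (1 / 2 : ℝ)

/-! ### Dyadic entropy sums and nets -/

section entropy

variable {E : Type*} [PseudoEMetricSpace E] (S : Set E)

theorem entropyRoot_antitone : Antitone (entropyRoot S) := by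
  intro u v huv
  refine ENNReal.rpow_le_rpow (EReal.toENNReal_le_toENNReal (ENNReal.log_le_log ?_)) (by norm_num)
  exact_mod_cast Metric.externalCoveringNumber_anti (Real.toNNReal_le_toNNReal huv)

theorem mul_entropyRoot_le_lintegral {u v : ℝ} (huv : u ≤ v) :
    ENNReal.ofReal (v - u) * entropyRoot S v + ∫⁻ x in Ioi v, entropyRoot S x
      ≤ ∫⁻ x in Ioi u, entropyRoot S x := by
  rw [← Ioc_union_Ioi_eq_Ioi huv,
    lintegral_union measurableSet_Ioi (Set.Ioc_disjoint_Ioi le_rfl)]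
  gcongr
  rw [mul_comm, ← Real.volume_Ioc, ← setLIntegral_const]
  exact setLIntegral_mono' measurableSet_Ioc fun x hx => entropyRoot_antitone S hx.2

/-- The integrand is antitone, so its value at `D / 2^(k+1)` bounds it below on the disjoint
interval from `D / 2^(k+2)` to there. That interval is half as long as the weight in the sum, hence
the factor 2. -/
theorem sum_entropyRoot_le {D : ℝ} (hD : 0 ≤ D) (K : ℕ) :
    ∑ k ∈ Finset.range K, ENNReal.ofReal (D / 2 ^ (k + 1)) * entropyRoot S (D / 2 ^ (k + 1))
      ≤ 2 * entropyIntegral S := by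
  have key : ∀ K : ℕ, ∑ k ∈ Finset.range K,
      ENNReal.ofReal (D / 2 ^ (k + 2)) * entropyRoot S (D / 2 ^ (k + 1))
      ≤ ∫⁻ x in Ioi (D / 2 ^ (K + 1)), entropyRoot S x := by
    intro K
    induction K with
    | zero => simp
    | succ K ih =>
      rw [Finset.sum_range_succ, add_comm]
      refine le_trans ?_ (mul_entropyRoot_le_lintegral S (v := D / 2 ^ (K + 1)) ?_)
      · gcongr
        rw [pow_succ _ (K + 1)]
        apply le_of_eq
        field_simp
        norm_num
      · gcongr
        · norm_num
        · omega
  calc _ = 2 * ∑ k ∈ Finset.range K,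
      ENNReal.ofReal (D / 2 ^ (k + 2)) * entropyRoot S (D / 2 ^ (k + 1)) := by
        rw [Finset.mul_sum]
        refine Finset.sum_congr rfl fun k _ => ?_
        rw [← mul_assoc]
        congr 1
        rw [show (2 : ℝ≥0∞) = ENNReal.ofReal 2 by simp, ← ENNReal.ofReal_mul (by norm_num)]
        congr 1
        rw [pow_succ _ (k + 1)]
        field_simp
    _ ≤ _ := by
        gcongr
        refine (key K).trans (lintegral_mono_set (Ioi_subset_Ioi (by positivity)))

theorem entropyRoot_ne_top (hg : entropyIntegral S ≠ ⊤) {u : ℝ} (hu : 0 < u) :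
    entropyRoot S u ≠ ⊤ := by
  intro h
  have := mul_entropyRoot_le_lintegral S hu.le
  rw [h, sub_zero, ENNReal.mul_top (by simpa using hu), top_add, top_le_iff] at this
  exact hg this

/-- At a scale with finite entropy, `S` has a net whose cardinality the entropy bounds. -/
theorem exists_net {u : ℝ} (h : entropyRoot S u ≠ ⊤) :
    ∃ T : Finset E, (T : Set E) ⊆ S ∧
      (∀ s ∈ S, ∃ t ∈ T, edist s t ≤ 2 * ENNReal.ofReal u) ∧
      (T.Nonempty → √(Real.log T.card) ≤ (entropyRoot S u).toReal) := by
  have hN : Metric.externalCoveringNumber u.toNNReal S ≠ ⊤ := by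
    intro h'
    apply h
    simp [entropyRoot, h']
  have hN' : Metric.coveringNumber (2 * u.toNNReal) S ≠ ⊤ :=
    -- Doubling the radius moves the centres into `S`, the only place where the increments of the
    -- process are controlled.
    ne_top_of_le_ne_top hN (Metric.coveringNumber_two_mul_le_externalCoveringNumber _ _)
  obtain ⟨T, hTS, hfin, hcov, hcard⟩ := Metric.exists_set_encard_eq_coveringNumber hN'
  refine ⟨hfin.toFinset, by simpa using hTS, ?_, ?_⟩
  · intro s hs
    obtain ⟨t, ht, hst⟩ := hcov hs
    exact ⟨t, by simpa using ht, by simpa [ENNReal.ofReal] using hst⟩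
  · intro hne
    have hle : ((hfin.toFinset.card : ℕ∞)) ≤ Metric.externalCoveringNumber u.toNNReal S := by
      rw [← hfin.encard_eq_coe_toFinset_card, hcard]
      exact Metric.coveringNumber_two_mul_le_externalCoveringNumber _ _
    have hc : 0 < hfin.toFinset.card := Finset.card_pos.2 hne
    have h3 : ENNReal.ofReal (Real.log hfin.toFinset.card) ^ (1 / 2 : ℝ) ≤ entropyRoot S u := by
      refine ENNReal.rpow_le_rpow ?_ (by norm_num)
      have : ENNReal.log (ENNReal.ofReal (hfin.toFinset.card : ℝ))
          = (Real.log hfin.toFinset.card : EReal) :=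
        ENNReal.log_ofReal_of_pos (by exact_mod_cast hc)
      rw [← EReal.real_coe_toENNReal, ← this]
      refine EReal.toENNReal_le_toENNReal (ENNReal.log_le_log ?_)
      rw [ENNReal.ofReal_natCast]
      exact_mod_cast hle
    have hlog : 0 ≤ Real.log hfin.toFinset.card := Real.log_natCast_nonneg _
    have h4 := ENNReal.toReal_mono h h3
    rwa [← ENNReal.toReal_rpow, ENNReal.toReal_ofReal hlog, ← Real.sqrt_eq_rpow] at h4

end entropy

/-- Dudley's bound for a process with sub-Gaussian increments on a finite probability space,
for the process evaluated at a random point `c`. -/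
theorem dudley_selection {Θ E : Type*} [Fintype Θ] [PseudoMetricSpace E] (q : Θ → ℝ)
    (hq : ∀ r, 0 ≤ q r) (h1 : ∑ r, q r = 1) (Y : E → Θ → ℝ) (S : Set E) {t₀ : E} (ht₀ : t₀ ∈ S)
    {D L σ : ℝ} (hD : 0 < D) (hσ : 0 ≤ σ) (hdiam : ∀ s ∈ S, dist s t₀ ≤ D)
    (hLip : ∀ s ∈ S, ∀ t ∈ S, ∀ r, Y s r - Y t r ≤ L * dist s t) (hL : 0 ≤ L)
    (hsub : ∀ s ∈ S, ∀ t ∈ S, ∀ l : ℝ, ∑ r, q r * Real.exp (l * (Y s r - Y t r))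
      ≤ Real.exp (l ^ 2 * (σ * dist s t) ^ 2))
    (hg : entropyIntegral S ≠ ⊤) (c : Θ → E) (hc : ∀ r, c r ∈ S) :
    ∑ r, q r * (Y (c r) r - Y t₀ r) ≤ 36 * σ * (entropyIntegral S).toReal := by
  set u : ℕ → ℝ := fun k => D / 2 ^ k with hu
  have hu0 : ∀ k, 0 < u k := fun k => by positivity
  have husucc : ∀ k, u k = 2 * u (k + 1) := fun k => by
    simp only [hu, pow_succ]; field_simp
  have hfin : ∀ k, entropyRoot S (u k) ≠ ⊤ := fun k => entropyRoot_ne_top S hg (hu0 k)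
  choose T₁ hT₁S hT₁cov hT₁card using fun k => exists_net S (hfin k)
  classical
  -- The coarsest net is the single point `t₀`, so the telescoping sum starts at `Y t₀`.
  set T : ℕ → Finset E := fun k => if k = 0 then {t₀} else T₁ k with hT
  have hTS : ∀ k, ∀ t ∈ T k, t ∈ S := by
    intro k t ht
    by_cases hk : k = 0
    · simp only [hT, hk, if_true, Finset.mem_singleton] at ht
      exact ht ▸ ht₀
    · simp only [hT, hk, if_false] at ht
      exact hT₁S k ht
  have hnet : ∀ k, ∀ s ∈ S, ∃ t ∈ T k, dist s t ≤ 2 * u k := by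
    intro k s hs
    by_cases hk : k = 0
    · refine ⟨t₀, by simp [hT, hk], (hdiam s hs).trans ?_⟩
      simp only [hu, hk, pow_zero]
      linarith
    · obtain ⟨t, ht, hst⟩ := hT₁cov k s hs
      refine ⟨t, by simpa [hT, hk] using ht, ?_⟩
      rw [edist_dist, show (2 : ℝ≥0∞) = ENNReal.ofReal 2 by simp,
        ← ENNReal.ofReal_mul (by norm_num)] at hst
      exact (ENNReal.ofReal_le_ofReal_iff (mul_pos two_pos (hu0 k)).le).1 hst
  have : ∀ k, ∃ f : E → E, ∀ s ∈ S, f s ∈ T k ∧ dist s (f s) ≤ 2 * u k := by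
    intro k
    choose! f hf using hnet k
    exact ⟨f, hf⟩
  choose f hf using this
  have hf0 : ∀ s ∈ S, f 0 s = t₀ := fun s hs => by simpa [hT] using (hf 0 s hs).1
  have hlogcard : ∀ j k, j ≤ k → Real.log (T j).card ≤ (entropyRoot S (u k)).toReal ^ 2 := by
    intro j k hjk
    rcases Nat.eq_zero_or_pos j with rfl | hj
    · simp only [hT, if_true, Finset.card_singleton, Nat.cast_one, Real.log_one]
      positivity
    · have hTj : T j = T₁ j := if_neg hj.ne'
      have hne : (T₁ j).Nonempty := ⟨_, hTj ▸ (hf j t₀ ht₀).1⟩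
      have huk : u k ≤ u j := by
        simp only [hu]
        gcongr
        norm_num
      have h2 := (hT₁card j hne).trans
        (ENNReal.toReal_mono (hfin k) (entropyRoot_antitone S huk))
      rw [hTj, ← Real.sq_sqrt (Real.log_natCast_nonneg (T₁ j).card)]
      exact pow_le_pow_left₀ (Real.sqrt_nonneg _) h2 2
  have hstep : ∀ k, ∑ r, q r * (Y (f (k + 1) (c r)) r - Y (f k (c r)) r)
      ≤ 18 * σ * (u (k + 1) * (entropyRoot S (u (k + 1))).toReal) := by
    intro k
    set h := (entropyRoot S (u (k + 1))).toReal
    have hh : 0 ≤ h := ENNReal.toReal_nonneg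
    have hu1 := hu0 (k + 1)
    have hpos : ∀ j, 0 < (T j).card := fun j => Finset.card_pos.2 ⟨_, (hf j t₀ ht₀).1⟩
    -- A link joins points within `2 u (k+1)` and `2 u k = 4 u (k+1)` of `c r`, so its length is at
    -- most `6 u (k+1)`.
    have hmax := sum_selection_le q hq h1 (fun (x : E × E) r => Y x.1 r - Y x.2 r)
      ((T (k + 1) ×ˢ T k).filter fun x => dist x.1 x.2 ≤ 6 * u (k + 1))
      (b := σ * (6 * u (k + 1))) (by positivity)
      (by
        intro x hx l
        rw [Finset.mem_filter, Finset.mem_product] at hx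
        refine (hsub _ (hTS _ _ hx.1.1) _ (hTS _ _ hx.1.2) l).trans (Real.exp_le_exp.2 ?_)
        gcongr
        exact hx.2)
      (fun r => (f (k + 1) (c r), f k (c r)))
      (by
        intro r
        have a1 := hf (k + 1) (c r) (hc r)
        have a2 := hf k (c r) (hc r)
        rw [Finset.mem_filter, Finset.mem_product]
        refine ⟨⟨a1.1, a2.1⟩, (dist_triangle_left _ _ (c r)).trans ?_⟩
        have := husucc k
        linarith [a1.2, a2.2])
      (N := (T (k + 1)).card * (T k).card)
      (by
        refine le_trans (Nat.cast_le.2 (Finset.card_filter_le _ _)) ?_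
        rw [Finset.card_product]
        push_cast
        exact le_rfl)
    refine hmax.trans ?_
    -- The logarithm is at most `2 h²`, and `2 ≤ (3 / 2)²`. The constant 18 is then `2 * 6 * (3 /
    -- 2)`; the dyadic sum doubles it to 36.
    have hsq : √(Real.log ((T (k + 1)).card * (T k).card)) ≤ 3 / 2 * h := by
      rw [Real.log_mul (by exact_mod_cast (hpos _).ne') (by exact_mod_cast (hpos _).ne')]
      refine Real.sqrt_le_iff.2 ⟨by positivity, ?_⟩
      have := hlogcard (k + 1) (k + 1) le_rfl
      have := hlogcard k (k + 1) (Nat.le_succ k)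
      nlinarith
    calc _ ≤ 2 * (σ * (6 * u (k + 1))) * (3 / 2 * h) := by gcongr
      _ = _ := by ring
  have htele : ∀ K, ∑ r, q r * (Y (f K (c r)) r - Y t₀ r)
      ≤ 36 * σ * (entropyIntegral S).toReal := by
    intro K
    have h2 : ∑ r, q r * (Y (f K (c r)) r - Y t₀ r)
        ≤ ∑ k ∈ Finset.range K, 18 * σ * (u (k + 1) * (entropyRoot S (u (k + 1))).toReal) := by
      induction K with
      | zero =>
        simp only [Finset.range_zero, Finset.sum_empty]
        refine Finset.sum_nonpos fun r _ => ?_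
        rw [hf0 _ (hc r), sub_self, mul_zero]
      | succ K ih =>
        rw [Finset.sum_range_succ]
        refine le_trans (le_of_eq ?_) (add_le_add ih (hstep K))
        rw [← Finset.sum_add_distrib]
        exact Finset.sum_congr rfl fun r _ => by ring
    refine h2.trans ?_
    rw [← Finset.mul_sum]
    have h3 := ENNReal.toReal_mono (ENNReal.mul_ne_top (by simp) hg) (sum_entropyRoot_le S hD.le K)
    rw [ENNReal.toReal_sum (fun k _ => ENNReal.mul_ne_top (by simp) (hfin _)),
      ENNReal.toReal_mul] at h3
    have h4 : ∑ k ∈ Finset.range K, u (k + 1) * (entropyRoot S (u (k + 1))).toReal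
        ≤ 2 * (entropyIntegral S).toReal := by
      refine le_trans (le_of_eq (Finset.sum_congr rfl fun k _ => ?_)) h3
      rw [ENNReal.toReal_mul, ENNReal.toReal_ofReal (hu0 _).le]
    nlinarith
  -- The error of stopping the chain at level `K` vanishes by the Lipschitz bound, so `L` may be
  -- crude: it does not enter the result.
  have hlim : Filter.Tendsto (fun K => 36 * σ * (entropyIntegral S).toReal + L * (2 * u K))
      Filter.atTop (nhds (36 * σ * (entropyIntegral S).toReal + L * (2 * 0))) := by
    refine Filter.Tendsto.const_add _ (Filter.Tendsto.const_mul _ (Filter.Tendsto.const_mul _ ?_))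
    have := tendsto_pow_atTop_nhds_zero_of_lt_one (r := (1 / 2 : ℝ)) (by norm_num) (by norm_num)
    have := this.const_mul D
    rw [mul_zero] at this
    refine this.congr fun k => ?_
    simp [hu, div_eq_mul_inv]
  rw [mul_zero, mul_zero, add_zero] at hlim
  refine ge_of_tendsto' hlim fun K => ?_
  calc ∑ r, q r * (Y (c r) r - Y t₀ r)
      ≤ ∑ r, (q r * (Y (f K (c r)) r - Y t₀ r) + q r * (L * (2 * u K))) := by
        refine Finset.sum_le_sum fun r _ => ?_
        rw [← mul_add]
        refine mul_le_mul_of_nonneg_left ?_ (hq r)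
        have := hLip (c r) (hc r) _ (hTS K _ (hf K _ (hc r)).1) r
        have := mul_le_mul_of_nonneg_left (hf K _ (hc r)).2 hL
        linarith
    _ ≤ _ := by
        rw [Finset.sum_add_distrib, ← Finset.sum_mul, h1, one_mul]
        exact add_le_add (htele K) le_rfl

/-! ### The permutation probability in terms of log-scores -/

/-- `log ∑_{x ∈ S} exp z_x`. -/
noncomputable def logSumExp {α : Type*} (z : α → ℝ) (S : Finset α) : ℝ :=
  Real.log (∑ x ∈ S, Real.exp (z x))

/-- The log-likelihood of the ranking `π` under the log-scores `z`. -/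
noncomputable def plLog {m : ℕ} (z : Fin m → ℝ) (π : Equiv.Perm (Fin m)) : ℝ :=
  ∑ k, z k - ∑ j, logSumExp z ((Finset.Ici j).image π)

/-! ### Log-sum-exp under exchange of one item -/

section logSumExp

variable {α : Type*}

theorem sum_exp_pos (z : α → ℝ) {S : Finset α} (hS : S.Nonempty) :
    0 < ∑ x ∈ S, Real.exp (z x) :=
  Finset.sum_pos (fun _ _ => Real.exp_pos _) hS

theorem logSumExp_sub_le {z z' : α → ℝ} {δ : ℝ} (h : ∀ x, |z x - z' x| ≤ δ) (S : Finset α)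
    (hS : S.Nonempty) : logSumExp z S - logSumExp z' S ≤ δ := by
  rw [sub_le_iff_le_add', logSumExp, logSumExp, Real.log_le_iff_le_exp (sum_exp_pos z hS),
    Real.exp_add, Real.exp_log (sum_exp_pos z' hS), Finset.sum_mul]
  refine Finset.sum_le_sum fun x _ => ?_
  rw [← Real.exp_add]
  exact Real.exp_le_exp.2 (by linarith [(abs_le.1 (h x)).2])

theorem abs_exp_sub_exp_le {a b C δ : ℝ} (ha : |a| ≤ C) (hb : |b| ≤ C) (h : |a - b| ≤ δ) :
    |Real.exp a - Real.exp b| ≤ Real.exp C * δ := by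
  wlog hab : b ≤ a generalizing a b
  · rw [abs_sub_comm]
    exact this hb ha (by rwa [abs_sub_comm]) (le_of_not_ge hab)
  rw [abs_of_nonneg (sub_nonneg.2 (Real.exp_le_exp.2 hab))]
  have h1 : Real.exp a - Real.exp b = Real.exp a * (1 - Real.exp (b - a)) := by
    rw [mul_sub, ← Real.exp_add]; ring_nf
  rw [h1]
  have h2 := Real.add_one_le_exp (b - a)
  have h3 := (abs_le.1 h).2
  have h4 : Real.exp a ≤ Real.exp C := Real.exp_le_exp.2 (abs_le.1 ha).2
  have h5 : Real.exp (b - a) ≤ 1 := Real.exp_le_one_iff.2 (by linarith)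
  exact mul_le_mul h4 (by linarith) (by linarith) (Real.exp_pos _).le

theorem log_div_sub_log_div_le {A A' B B' u v : ℝ} (hA : 0 < A) (hA' : 0 < A') (hB : 0 < B)
    (hB' : 0 < B') (hv : 0 < v) (hu : 0 ≤ u) (hvle : v ≤ A' * B) (h : A * B' - A' * B ≤ u) :
    (Real.log A - Real.log A') - (Real.log B - Real.log B') ≤ u / v := by
  have e : (Real.log A - Real.log A') - (Real.log B - Real.log B')
      = Real.log (A * B' / (A' * B)) := by
    rw [Real.log_div (by positivity) (by positivity), Real.log_mul hA.ne' hB'.ne',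
      Real.log_mul hA'.ne' hB.ne']
    ring
  rw [e]
  refine (Real.log_le_sub_one_of_pos (by positivity)).trans ?_
  rw [div_sub_one (by positivity)]
  calc _ ≤ u / (A' * B) := by gcongr
    _ ≤ u / v := by gcongr

/-- The gain over the trivial bound `2 δ` is the factor `1 / (T.card + 1)`. The left side is the
logarithm of a ratio of products of two sums; the denominator is of order `(T.card + 1)²`, while the
numerator minus the denominator is only of order `(T.card + 1) δ`. -/
theorem logSumExp_exchange_le [DecidableEq α] {z z' : α → ℝ} {C δ : ℝ} (hz : ∀ x, |z x| ≤ C)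
    (hz' : ∀ x, |z' x| ≤ C) (h : ∀ x, |z x - z' x| ≤ δ) (hδ : 0 ≤ δ) (T : Finset α) (x y : α)
    (hx : x ∉ T) (hy : y ∉ T) :
    (logSumExp z (insert x T) - logSumExp z' (insert x T))
        - (logSumExp z (insert y T) - logSumExp z' (insert y T))
      ≤ 3 * Real.exp (4 * C) * δ / (T.card + 1) := by
  set M := Real.exp C with hM
  have hM0 : 0 < M := Real.exp_pos _
  set W := ∑ x ∈ T, Real.exp (z x) with hW
  set W' := ∑ x ∈ T, Real.exp (z' x) with hW'
  set t : ℝ := (T.card : ℝ) with ht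
  have ht0 : 0 ≤ t := Nat.cast_nonneg _
  have up : ∀ a, Real.exp (z a) ≤ M := fun a => Real.exp_le_exp.2 (abs_le.1 (hz a)).2
  have up' : ∀ a, Real.exp (z' a) ≤ M := fun a => Real.exp_le_exp.2 (abs_le.1 (hz' a)).2
  have lo : ∀ a, M⁻¹ ≤ Real.exp (z a) := fun a => by
    rw [hM, ← Real.exp_neg]; exact Real.exp_le_exp.2 (abs_le.1 (hz a)).1
  have lo' : ∀ a, M⁻¹ ≤ Real.exp (z' a) := fun a => by
    rw [hM, ← Real.exp_neg]; exact Real.exp_le_exp.2 (abs_le.1 (hz' a)).1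
  have df : ∀ a, |Real.exp (z a) - Real.exp (z' a)| ≤ M * δ := fun a =>
    abs_exp_sub_exp_le (hz a) (hz' a) (h a)
  have hWW : |W - W'| ≤ t * (M * δ) := by
    rw [hW, hW', ← Finset.sum_sub_distrib]
    refine (Finset.abs_sum_le_sum_abs _ _).trans ((Finset.sum_le_sum fun a _ => df a).trans ?_)
    rw [Finset.sum_const, nsmul_eq_mul]
  have hW'0 : 0 ≤ W' := Finset.sum_nonneg fun _ _ => (Real.exp_pos _).le
  have hW'u : W' ≤ t * M := by
    refine (Finset.sum_le_sum fun a _ => up' a).trans ?_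
    rw [Finset.sum_const, nsmul_eq_mul]
  have hWl : t * M⁻¹ ≤ W := by
    refine le_trans ?_ (Finset.sum_le_sum fun a _ => lo a)
    rw [Finset.sum_const, nsmul_eq_mul]
  have hW'l : t * M⁻¹ ≤ W' := by
    refine le_trans ?_ (Finset.sum_le_sum fun a _ => lo' a)
    rw [Finset.sum_const, nsmul_eq_mul]
  have hMi : 0 < M⁻¹ := inv_pos.2 hM0
  have key := log_div_sub_log_div_le (A := Real.exp (z x) + W) (A' := Real.exp (z' x) + W')
    (B := Real.exp (z y) + W) (B' := Real.exp (z' y) + W') (u := 3 * (t + 1) * (M ^ 2 * δ))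
    (v := (t + 1) ^ 2 * (M⁻¹ ^ 2))
    (by linarith [lo x, mul_nonneg ht0 hMi.le]) (by linarith [lo' x])
    (by linarith [lo y, mul_nonneg ht0 hMi.le]) (by linarith [lo' y]) (by positivity)
    (by positivity) ?_ ?_
  · simp only [logSumExp, Finset.sum_insert hx, Finset.sum_insert hy]
    refine key.trans (le_of_eq ?_)
    rw [show 4 * C = C + C + C + C by ring, Real.exp_add, Real.exp_add, Real.exp_add, ← hM]
    field_simp
  · have a1 : (t + 1) * M⁻¹ ≤ Real.exp (z' x) + W' := by linarith [lo' x]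
    have a2 : (t + 1) * M⁻¹ ≤ Real.exp (z y) + W := by linarith [lo y]
    calc _ = ((t + 1) * M⁻¹) * ((t + 1) * M⁻¹) := by ring
      _ ≤ _ := mul_le_mul a1 a2 (by positivity) (by linarith [lo' x])
  · set a := Real.exp (z x)
    set a' := Real.exp (z' x)
    set b := Real.exp (z y)
    set b' := Real.exp (z' y)
    have ha0 : 0 < a := Real.exp_pos _
    have ha0' : 0 < a' := Real.exp_pos _
    have hb0 : 0 < b := Real.exp_pos _
    have hb0' : 0 < b' := Real.exp_pos _
    -- The quadratic term `W * W'` cancels; each remaining term has at most one factor of size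
    -- `T.card` and one small difference.
    have e : (a + W) * (b' + W') - (a' + W') * (b + W)
        = (W - W') * (b' - a') + W' * ((a - a') - (b - b')) + (a * (b' - b) + b * (a - a')) := by
      ring
    have c1 : (W - W') * (b' - a') ≤ t * (M * δ) * M := by
      refine (le_abs_self _).trans ?_
      rw [abs_mul]
      refine mul_le_mul hWW ?_ (abs_nonneg _) (by positivity)
      rw [abs_le]
      constructor <;> linarith [up' x, up' y]
    have hax := abs_le.1 (df x)
    have hay := abs_le.1 (df y)
    have c2 : W' * ((a - a') - (b - b')) ≤ (t * M) * (2 * (M * δ)) := by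
      refine (mul_le_mul_of_nonneg_left (b := (a - a') - (b - b')) (c := 2 * (M * δ))
        (by linarith [hax.2, hay.1]) hW'0).trans ?_
      exact mul_le_mul_of_nonneg_right hW'u (by positivity)
    have c3 : a * (b' - b) ≤ M * (M * δ) := by
      refine (mul_le_mul_of_nonneg_left (b := b' - b) (c := M * δ)
        (by linarith [hay.1]) ha0.le).trans ?_
      exact mul_le_mul_of_nonneg_right (up x) (by positivity)
    have c4 : b * (a - a') ≤ M * (M * δ) := by
      refine (mul_le_mul_of_nonneg_left hax.2 hb0.le).trans ?_
      exact mul_le_mul_of_nonneg_right (up y) (by positivity)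
    rw [e]
    have : 0 ≤ M ^ 2 * δ := by positivity
    nlinarith

end logSumExp

/-! ### The log-likelihood of a single ranking -/

section ranking

variable {m : ℕ}

theorem image_Ici_nonempty (π : Equiv.Perm (Fin m)) (j : Fin m) :
    ((Finset.Ici j).image π).Nonempty := ⟨π j, by simp⟩

theorem permProb_eq_exp_plLog {φ : ℝ → ℝ} (hφ : ∀ x, 0 < φ x) (s : Fin m → ℝ)
    (π : Equiv.Perm (Fin m)) :
    permProb φ s π = Real.exp (plLog (fun k => Real.log (φ (s k))) π) := by
  rw [plLog, ← Equiv.sum_comp π, ← Finset.sum_sub_distrib, Real.exp_sum, permProb]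
  refine Finset.prod_congr rfl fun j _ => ?_
  rw [Real.exp_sub, Real.exp_log (hφ _), logSumExp,
    Real.exp_log (sum_exp_pos _ (image_Ici_nonempty π j)),
    Finset.sum_image (π.injective.injOn)]
  simp only [Real.exp_log (hφ _)]

theorem exp_plLog_eq_prod (z : Fin m → ℝ) (π : Equiv.Perm (Fin m)) :
    Real.exp (plLog z π)
      = ∏ j, drawProb (fun k => Real.exp (z k)) (π j) ((Finset.Ici j).image π) := by
  rw [plLog, ← Equiv.sum_comp π, ← Finset.sum_sub_distrib, Real.exp_sum]
  refine Finset.prod_congr rfl fun j _ => ?_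
  rw [Real.exp_sub, logSumExp, Real.exp_log (sum_exp_pos _ (image_Ici_nonempty π j)), drawProb]

theorem seqSum_drawProb {α : Type*} [DecidableEq α] {w : α → ℝ} (hw : ∀ a, 0 < w a) (k : ℕ)
    (S : Finset α) (hS : S.card = k) : seqSum (drawProb w) k S = 1 := by
  induction k generalizing S with
  | zero => rfl
  | succ k ih =>
    rw [seqSum, ← sum_drawProb hw (Finset.card_pos.1 (by omega : 0 < S.card))]
    refine Finset.sum_congr rfl fun a ha => ?_
    rw [ih _ (by rw [Finset.card_erase_of_mem ha, hS]; rfl), mul_one]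

theorem sum_exp_plLog (z : Fin m → ℝ) : ∑ π : Equiv.Perm (Fin m), Real.exp (plLog z π) = 1 := by
  simp only [exp_plLog_eq_prod]
  rw [sum_perm_eq_seqSum, seqSum_drawProb (fun _ => Real.exp_pos _) _ _ (by simp)]

/-- The mean log-likelihood of `z` when the ranking is drawn with log-scores `zs`. -/
noncomputable def plMean (zs z : Fin m → ℝ) : ℝ :=
  ∑ π : Equiv.Perm (Fin m), Real.exp (plLog zs π) * plLog z π

/-- The constant 1 in the harmonic bound is absorbed because `log m ≥ log 2 > 1 / 2`. -/
theorem sum_inv_le_log (hm : 2 ≤ m) :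
    ∑ i ∈ Finset.range m, (1 : ℝ) / (i + 1) ≤ 3 * Real.log m := by
  have h := harmonic_le_one_add_log m
  have h2 : Real.log 2 ≤ Real.log m :=
    Real.log_le_log (by norm_num) (by exact_mod_cast hm)
  have h3 := Real.log_two_gt_d9
  have e : ((harmonic m : ℚ) : ℝ) = ∑ i ∈ Finset.range m, (1 : ℝ) / (i + 1) := by
    simp [harmonic]
  rw [← e]
  linarith

/-- The log-likelihood ratio of a random ranking is sub-Gaussian, with a variance proxy of order
`m (log m)²` times the squared distance of the log-scores. -/
theorem plLog_mgf_le (hm : 2 ≤ m) (zs : Fin m → ℝ) {z z' : Fin m → ℝ} {C δ : ℝ}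
    (hz : ∀ x, |z x| ≤ C) (hz' : ∀ x, |z' x| ≤ C) (h : ∀ x, |z x - z' x| ≤ δ) (hδ : 0 ≤ δ)
    (l : ℝ) :
    ∑ π : Equiv.Perm (Fin m), Real.exp (plLog zs π) *
        Real.exp (l * ((plLog z π - plMean zs z) - (plLog z' π - plMean zs z')))
      ≤ Real.exp (l ^ 2 * (9 * Real.exp (4 * C) * (√m * Real.log m) * δ) ^ 2) := by
  set w : Fin m → ℝ := fun k => Real.exp (zs k) with hwdef
  have hw : ∀ a, 0 < w a := fun a => Real.exp_pos _
  set G : Finset (Fin m) → ℝ := fun S => logSumExp z' S - logSumExp z S with hG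
  set X : Equiv.Perm (Fin m) → ℝ := fun π => ∑ j, G ((Finset.Ici j).image π) with hX
  set A : ℝ := 3 * Real.exp (4 * C) * δ with hA
  have hA0 : 0 ≤ A := by positivity
  set B : ℝ := ∑ i ∈ Finset.range m, A / ((i : ℝ) + 1) with hB
  set H := seqMean (drawProb w) G m Finset.univ with hH
  have hGex : ∀ T : Finset (Fin m), ∀ x ∉ T, ∀ y ∉ T,
      |G (insert x T) - G (insert y T)| ≤ A / ((T.card : ℝ) + 1) := by
    intro T x hx y hy
    have h' : ∀ x, |z' x - z x| ≤ δ := fun x => by rw [abs_sub_comm]; exact h x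
    rw [abs_le]
    constructor
    · have := logSumExp_exchange_le hz' hz h' hδ T y x hy hx
      simp only [hG]
      linarith
    · exact logSumExp_exchange_le hz' hz h' hδ T x y hx hy
  have hBex : ∀ t ≤ m, ∀ T : Finset (Fin m), T.card + 1 = t → ∀ x ∉ T, ∀ y ∉ T,
      |seqMean (drawProb w) G t (insert x T) - seqMean (drawProb w) G t (insert y T)| ≤ B := by
    intro t ht T hT x hx y hy
    refine (seqMean_exchange hw (b := fun i => A / ((i : ℝ) + 1)) (fun i => by positivity) hGex t
      T hT x hx y hy).trans ?_
    exact Finset.sum_le_sum_of_subset_of_nonneg (Finset.range_mono ht)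
      fun i _ _ => by positivity
  have hmgf : ∀ l : ℝ, ∑ π : Equiv.Perm (Fin m), Real.exp (plLog zs π) * Real.exp (l * X π)
      ≤ Real.exp (l * H + m * B ^ 2 * l ^ 2) := by
    intro l
    have e := sum_perm_eq_seqSum (fun a (S : Finset (Fin m)) =>
      drawProb w a S * Real.exp (l * G S))
    have e2 := seqSum_exp_le hw hBex l m le_rfl Finset.univ (by simp)
    rw [← e] at e2
    refine le_trans (le_of_eq (Finset.sum_congr rfl fun π _ => ?_))
      (e2.trans (le_of_eq (by congr 1; ring)))
    rw [Finset.prod_mul_distrib, ← Real.exp_sum, ← Finset.mul_sum, exp_plLog_eq_prod]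
  -- The exponential bound itself identifies the recursive value `H` as the mean of `X`, in place of
  -- a separate tower-property induction.
  have hmean := mean_eq_of_mgf_le Finset.univ (fun π => Real.exp (plLog zs π)) X
    (fun _ _ => (Real.exp_pos _).le) (sum_exp_plLog zs) H (by positivity) hmgf
  have hdiff : ∀ π, plLog z π - plLog z' π = (∑ k, z k - ∑ k, z' k) + X π := by
    intro π
    simp only [plLog, hX, hG, Finset.sum_sub_distrib]
    ring
  have hmd : plMean zs z - plMean zs z' = (∑ k, z k - ∑ k, z' k) + H := by
    rw [plMean, plMean, ← Finset.sum_sub_distrib]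
    simp only [← mul_sub, hdiff, mul_add, Finset.sum_add_distrib]
    rw [← Finset.sum_mul, ← hmean, sum_exp_plLog, one_mul]
  have hcent : ∀ π, (plLog z π - plMean zs z) - (plLog z' π - plMean zs z') = X π - H := by
    intro π
    linarith [hdiff π]
  have hBle : B ≤ A * (3 * Real.log m) := by
    rw [hB]
    calc _ = A * ∑ i ∈ Finset.range m, (1 : ℝ) / (i + 1) := by
          rw [Finset.mul_sum]
          exact Finset.sum_congr rfl fun i _ => by ring
      _ ≤ _ := mul_le_mul_of_nonneg_left (sum_inv_le_log hm) hA0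
  have hB0 : 0 ≤ B := Finset.sum_nonneg fun i _ => by positivity
  calc _ = Real.exp (-(l * H)) * ∑ π : Equiv.Perm (Fin m),
        Real.exp (plLog zs π) * Real.exp (l * X π) := by
        rw [Finset.mul_sum]
        refine Finset.sum_congr rfl fun π _ => ?_
        rw [hcent, show l * (X π - H) = -(l * H) + l * X π by ring, Real.exp_add]
        ring
    _ ≤ Real.exp (-(l * H)) * Real.exp (l * H + m * B ^ 2 * l ^ 2) :=
        mul_le_mul_of_nonneg_left (hmgf l) (Real.exp_pos _).le
    _ ≤ _ := by
        rw [← Real.exp_add]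
        refine Real.exp_le_exp.2 ?_
        have h5 : B ^ 2 ≤ (A * (3 * Real.log m)) ^ 2 := pow_le_pow_left₀ hB0 hBle 2
        have h6 : √(m : ℝ) ^ 2 = m := Real.sq_sqrt (Nat.cast_nonneg m)
        calc _ = l ^ 2 * (m * B ^ 2) := by ring
          _ ≤ l ^ 2 * (m * (A * (3 * Real.log m)) ^ 2) := by gcongr
          _ = _ := by
            rw [← h6, hA, h6]
            simp only [mul_pow, h6]
            ring

theorem plLog_sub_le {z z' : Fin m → ℝ} {δ : ℝ} (h : ∀ x, |z x - z' x| ≤ δ)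
    (π : Equiv.Perm (Fin m)) : plLog z π - plLog z' π ≤ 2 * m * δ := by
  have e : plLog z π - plLog z' π = ∑ k, ((z k - z' k)
      + (logSumExp z' ((Finset.Ici k).image π) - logSumExp z ((Finset.Ici k).image π))) := by
    simp only [plLog, Finset.sum_add_distrib, Finset.sum_sub_distrib]
    ring
  rw [e]
  calc _ ≤ ∑ _k : Fin m, (δ + δ) := Finset.sum_le_sum fun k _ => add_le_add (abs_le.1 (h k)).2
        (logSumExp_sub_le (fun x => by rw [abs_sub_comm]; exact h x) _ (image_Ici_nonempty π k))
    _ = _ := by rw [Finset.sum_const, Finset.card_univ, Fintype.card_fin, nsmul_eq_mul]; ring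

theorem plMean_sub_le (zs : Fin m → ℝ) {z z' : Fin m → ℝ} {δ : ℝ} (h : ∀ x, |z x - z' x| ≤ δ) :
    plMean zs z - plMean zs z' ≤ 2 * m * δ := by
  rw [plMean, plMean, ← Finset.sum_sub_distrib]
  calc _ ≤ ∑ π : Equiv.Perm (Fin m), Real.exp (plLog zs π) * (2 * m * δ) :=
        Finset.sum_le_sum fun π _ => by
          rw [← mul_sub]
          exact mul_le_mul_of_nonneg_left (plLog_sub_le h π) (Real.exp_pos _).le
    _ = _ := by rw [← Finset.sum_mul, sum_exp_plLog, one_mul]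

end ranking

/-! ### The maximum likelihood estimator -/

section process

variable {n m : ℕ}

/-- The probability of the rankings `r` under independent rows with log-scores `Zs`. -/
noncomputable def rowsProb (Zs : InfTwoMatrix n m) (r : Fin n → Equiv.Perm (Fin m)) : ℝ :=
  ∏ i, Real.exp (plLog (Zs i) (r i))

/-- The centred log-likelihood of `Z` when the rankings are drawn with log-scores `Zs`. -/
noncomputable def centredLogLik (Zs Z : InfTwoMatrix n m) (r : Fin n → Equiv.Perm (Fin m)) : ℝ :=
  ∑ i, (plLog (Z i) (r i) - plMean (Zs i) (Z i))

theorem rowsProb_pos (Zs : InfTwoMatrix n m) (r : Fin n → Equiv.Perm (Fin m)) :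
    0 < rowsProb Zs r := Finset.prod_pos fun _ _ => Real.exp_pos _

theorem sum_prod_rows (F : Fin n → Equiv.Perm (Fin m) → ℝ) :
    ∑ r : Fin n → Equiv.Perm (Fin m), ∏ i, F i (r i) = ∏ i, ∑ π, F i π := by
  rw [Finset.prod_univ_sum, Fintype.piFinset_univ]

theorem sum_rowsProb (Zs : InfTwoMatrix n m) : ∑ r, rowsProb Zs r = 1 := by
  simp only [rowsProb]
  rw [sum_prod_rows (fun i π => Real.exp (plLog (Zs i) π))]
  exact Finset.prod_eq_one fun i _ => sum_exp_plLog _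

theorem centredLogLik_mgf_le (hm : 2 ≤ m) (Zs Z Z' : InfTwoMatrix n m) {C : ℝ}
    (hZ : ∀ i j, |Z i j| ≤ C) (hZ' : ∀ i j, |Z' i j| ≤ C) (l : ℝ) :
    ∑ r, rowsProb Zs r * Real.exp (l * (centredLogLik Zs Z r - centredLogLik Zs Z' r))
      ≤ Real.exp (l ^ 2 * (9 * Real.exp (4 * C) * (√m * Real.log m) * dist Z Z') ^ 2) := by
  calc _ = ∏ i, ∑ π, Real.exp (plLog (Zs i) π) * Real.exp (l *
        ((plLog (Z i) π - plMean (Zs i) (Z i)) - (plLog (Z' i) π - plMean (Zs i) (Z' i)))) := by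
        rw [← sum_prod_rows]
        refine Finset.sum_congr rfl fun r _ => ?_
        rw [Finset.prod_mul_distrib, rowsProb, centredLogLik, centredLogLik,
          ← Finset.sum_sub_distrib, Finset.mul_sum, Real.exp_sum]
    _ ≤ ∏ i, Real.exp (l ^ 2 * (9 * Real.exp (4 * C) * (√m * Real.log m) *
          dist (Z i) (Z' i)) ^ 2) := by
        refine Finset.prod_le_prod (fun i _ => Finset.sum_nonneg fun π _ => by positivity)
          fun i _ => ?_
        refine plLog_mgf_le hm (Zs i) (hZ i) (hZ' i) (fun x => ?_) dist_nonneg l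
        rw [← Real.dist_eq]
        exact dist_le_pi_dist (Z i) (Z' i) x
    _ = _ := by
        rw [← Real.exp_sum, PiLp.dist_eq_of_L2]
        congr 1
        rw [mul_pow, Real.sq_sqrt (Finset.sum_nonneg fun i _ => sq_nonneg _), ← Finset.mul_sum]
        congr 1
        rw [Finset.mul_sum]
        exact Finset.sum_congr rfl fun i _ => mul_pow _ _ _

theorem centredLogLik_sub_le (Zs Z Z' : InfTwoMatrix n m) (r : Fin n → Equiv.Perm (Fin m)) :
    centredLogLik Zs Z r - centredLogLik Zs Z' r ≤ (4 * n * m) * dist Z Z' := by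
  have hrow : ∀ i, dist (Z i) (Z' i) ≤ dist Z Z' := fun i => by
    rw [dist_eq_norm, dist_eq_norm]
    exact PiLp.norm_apply_le (Z - Z') i
  have h : ∀ i x, |Z i x - Z' i x| ≤ dist Z Z' := fun i x => by
    rw [← Real.dist_eq]
    exact (dist_le_pi_dist (Z i) (Z' i) x).trans (hrow i)
  rw [centredLogLik, centredLogLik, ← Finset.sum_sub_distrib]
  calc _ ≤ ∑ _i : Fin n, 4 * m * dist Z Z' := Finset.sum_le_sum fun i _ => by
        have h1 := plLog_sub_le (h i) (r i)
        have h2 := plMean_sub_le (Zs i) (z := Z' i) (z' := Z i)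
          (fun x => by rw [abs_sub_comm]; exact h i x)
        linarith
    _ = _ := by rw [Finset.sum_const, Finset.card_univ, Fintype.card_fin, nsmul_eq_mul]; ring

/-- The centred log-likelihood exceeds its value at the truth by more than the entropy bound only
with small probability. -/
theorem sum_rowsProb_exceed_le (hm : 2 ≤ m) {S : Set (InfTwoMatrix n m)} {Zs : InfTwoMatrix n m}
    (hZs : Zs ∈ S) {C ε : ℝ} (hε : 0 < ε) (hS : ∀ Z ∈ S, ∀ i j, |Z i j| ≤ C)
    (hg : entropyIntegral S ≠ ⊤) (A : Finset (Fin n → Equiv.Perm (Fin m)))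
    (hA : ∀ r ∈ A, ∃ Z ∈ S, 36 / ε * (9 * Real.exp (4 * C)) * (√m * Real.log m) *
      (entropyIntegral S).toReal < centredLogLik Zs Z r - centredLogLik Zs Zs r) :
    ∑ r ∈ A, rowsProb Zs r ≤ ε := by
  classical
  set σ := 9 * Real.exp (4 * C) * (√m * Real.log m) with hσ
  set g := (entropyIntegral S).toReal with hgdef
  have hσ0 : 0 ≤ σ := by positivity
  have hg0 : 0 ≤ g := ENNReal.toReal_nonneg
  choose! sel hselS hsel using hA
  -- Off the bad event the selected point is the truth, where the increment is zero; the mean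
  -- increment is thus carried by `A`, and Markov's inequality applies.
  set c : (Fin n → Equiv.Perm (Fin m)) → InfTwoMatrix n m := fun r => if r ∈ A then sel r else Zs
  have hcS : ∀ r, c r ∈ S := fun r => by
    by_cases hr : r ∈ A
    · simpa [c, hr] using hselS r hr
    · simpa [c, hr] using hZs
  have hdiam : ∃ D : ℝ, 0 < D ∧ ∀ Z ∈ S, dist Z Zs ≤ D := by
    refine ⟨√(∑ _i : Fin n, (2 * |C|) ^ 2) + 1, by positivity, fun Z hZ => ?_⟩
    rw [PiLp.dist_eq_of_L2]
    refine le_trans (Real.sqrt_le_sqrt (Finset.sum_le_sum fun i _ => ?_))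
      (le_add_of_nonneg_right zero_le_one)
    refine pow_le_pow_left₀ dist_nonneg ?_ 2
    refine (dist_pi_le_iff (by positivity)).2 fun j => ?_
    rw [Real.dist_eq]
    have h1 := (hS Z hZ i j).trans (le_abs_self C)
    have h2 := (hS Zs hZs i j).trans (le_abs_self C)
    exact (abs_sub _ _).trans (by linarith)
  obtain ⟨D, hD, hdiam⟩ := hdiam
  have hdud := dudley_selection (rowsProb Zs) (fun r => (rowsProb_pos Zs r).le) (sum_rowsProb Zs)
    (centredLogLik Zs) S hZs hD hσ0 hdiam (L := 4 * n * m)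
    (fun Z _ Z' _ r => centredLogLik_sub_le Zs Z Z' r) (by positivity)
    (fun Z hZ Z' hZ' l => centredLogLik_mgf_le hm Zs Z Z' (hS Z hZ) (hS Z' hZ') l) hg c hcS
  have hsum : ∑ r, rowsProb Zs r * (centredLogLik Zs (c r) r - centredLogLik Zs Zs r)
      = ∑ r ∈ A, rowsProb Zs r * (centredLogLik Zs (sel r) r - centredLogLik Zs Zs r) := by
    rw [← Finset.sum_filter_add_sum_filter_not Finset.univ (· ∈ A)]
    rw [Finset.sum_eq_zero (s := Finset.univ.filter fun r => r ∉ A), add_zero]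
    · rw [Finset.filter_mem_eq_inter, Finset.univ_inter]
      exact Finset.sum_congr rfl fun r hr => by simp [c, hr]
    · intro r hr
      simp [c, (Finset.mem_filter.1 hr).2]
  rw [hsum] at hdud
  by_contra! hcon
  have hAne : A.Nonempty := by
    by_contra h
    rw [Finset.not_nonempty_iff_eq_empty] at h
    rw [h, Finset.sum_empty] at hcon
    linarith
  have hlt : ∑ r ∈ A, rowsProb Zs r * (36 / ε * σ * g)
      < ∑ r ∈ A, rowsProb Zs r * (centredLogLik Zs (sel r) r - centredLogLik Zs Zs r) := by
    refine Finset.sum_lt_sum_of_nonempty hAne fun r hr => ?_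
    refine mul_lt_mul_of_pos_left ?_ (rowsProb_pos Zs r)
    refine lt_of_eq_of_lt ?_ (hsel r hr)
    rw [hσ]
    ring
  rw [← Finset.sum_mul] at hlt
  have h1 : ε * (36 / ε * σ * g) ≤ (∑ r ∈ A, rowsProb Zs r) * (36 / ε * σ * g) :=
    mul_le_mul_of_nonneg_right hcon.le (by positivity)
  have h2 : ε * (36 / ε * σ * g) = 36 * σ * g := by field_simp
  linarith

end process

/-! ### From the likelihood process to the estimator -/

theorem permProb_eq_one_of_le_one {m : ℕ} (hm : m ≤ 1) {φ : ℝ → ℝ} (hφ : ∀ x, 0 < φ x)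
    (s : Fin m → ℝ) (π : Equiv.Perm (Fin m)) : permProb φ s π = 1 := by
  have : Subsingleton (Fin m) := Fin.subsingleton_iff_le_one.2 hm
  refine Finset.prod_eq_one fun j _ => ?_
  have : Finset.Ici j = {j} := by
    ext k
    simp [Subsingleton.elim k j]
  rw [this, Finset.sum_singleton, div_self (hφ _).ne']

/-- The basic inequality: the divergence from the truth to the estimator is at most the increment
of the centred log-likelihood. -/
theorem mul_avgKL_le {n m : ℕ} (hn : n ≠ 0) {φ : ℝ → ℝ} (hφ : ∀ x, 0 < φ x)
    {Xs X : Matrix (Fin n) (Fin m) ℝ} {r : Fin n → Equiv.Perm (Fin m)}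
    (h : negLogLik φ r X ≤ negLogLik φ r Xs) (Zs Z : InfTwoMatrix n m)
    (hZs : Zs = WithLp.toLp 2 fun i j => Real.log (φ (Xs i j)))
    (hZ : Z = WithLp.toLp 2 fun i j => Real.log (φ (X i j))) :
    n * avgKL φ Xs X ≤ centredLogLik Zs Z r - centredLogLik Zs Zs r := by
  have hs : ∀ i π, permProb φ (Xs i) π = Real.exp (plLog (Zs i) π) := fun i π => by
    rw [permProb_eq_exp_plLog hφ, hZs]
  have hx : ∀ i π, permProb φ (X i) π = Real.exp (plLog (Z i) π) := fun i π => by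
    rw [permProb_eq_exp_plLog hφ, hZ]
  have hkl : n * avgKL φ Xs X = ∑ i, (plMean (Zs i) (Zs i) - plMean (Zs i) (Z i)) := by
    rw [avgKL, ← mul_assoc, mul_one_div_cancel (by exact_mod_cast hn), one_mul]
    refine Finset.sum_congr rfl fun i _ => ?_
    rw [plMean, plMean, ← Finset.sum_sub_distrib]
    refine Finset.sum_congr rfl fun π _ => ?_
    rw [hs, hx, ← Real.exp_sub, Real.log_exp, mul_sub]
  simp only [negLogLik, hs, hx, ← Real.exp_sum, Real.log_exp] at h
  rw [hkl, centredLogLik, centredLogLik]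
  simp only [Finset.sum_sub_distrib]
  linarith

theorem theorem2 (C : ℝ) (ε : ℝ) (hε : 0 < ε) :
    ∃ K : ℝ, 0 < K ∧
      ∀ (n m : ℕ) (φ : ℝ → ℝ), Monotone φ → (∀ x, 0 < φ x) →
      ∀ (𝒳 : Set (Matrix (Fin n) (Fin m) ℝ)),
        (∀ X ∈ 𝒳, ∀ i j, |Real.log (φ (X i j))| ≤ C) →
      ∀ Xstar ∈ 𝒳,
      ∀ (Ω : Type*) [MeasurableSpace Ω] (μ : Measure Ω) [IsProbabilityMeasure μ]
        (R : Fin n → Ω → Equiv.Perm (Fin m)),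
        (∀ i, Measurable (R i)) →
        iIndepFun R μ →
        (∀ i π, μ {ω | R i ω = π} = ENNReal.ofReal (permProb φ (Xstar i) π)) →
      ∀ (Xhat : Ω → Matrix (Fin n) (Fin m) ℝ),
        (∀ᵐ ω ∂μ, Xhat ω ∈ 𝒳 ∧
          IsMinOn (negLogLik φ fun i => R i ω) 𝒳 (Xhat ω)) →
        μ {ω | ENNReal.ofReal (K * (√(m : ℝ) * Real.log m / n)) *
              entropyIntegral (logScores φ 𝒳) < ENNReal.ofReal (avgKL φ Xstar (Xhat ω))}
          ≤ ENNReal.ofReal ε := by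
  refine ⟨36 / ε * (9 * Real.exp (4 * C)), by positivity, ?_⟩
  intro n m φ _ hφ 𝒳 hC Xs hXs Ω _ μ _ R _ hind hlaw Xhat hhat
  set K := 36 / ε * (9 * Real.exp (4 * C)) with hK
  have hK0 : 0 < K := by positivity
  by_cases hn : n = 0
  · subst hn
    simp [avgKL]
  by_cases hm : m ≤ 1
  -- Here `log m = 0` makes the rate vanish, but there is at most one ranking and the divergence is
  -- zero.
  · simp [avgKL, permProb_eq_one_of_le_one hm hφ]
  rw [not_le] at hm
  have hn0 : (0 : ℝ) < n := by exact_mod_cast Nat.pos_of_ne_zero hn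
  have hm0 : (1 : ℝ) < m := by exact_mod_cast hm
  have hrate : 0 < K * (√(m : ℝ) * Real.log m / n) :=
    mul_pos hK0 (div_pos (mul_pos (Real.sqrt_pos.2 (by linarith)) (Real.log_pos hm0)) hn0)
  set S := logScores φ 𝒳 with hS
  by_cases hg : entropyIntegral S = ⊤
  -- For `m ≥ 2` the rate is positive, so an infinite entropy integral makes the threshold infinite
  -- and the event empty.
  · simp [hg, ENNReal.mul_top (ENNReal.ofReal_pos.2 hrate).ne']
  set toZ : Matrix (Fin n) (Fin m) ℝ → InfTwoMatrix n m :=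
    fun X => WithLp.toLp 2 fun i j => Real.log (φ (X i j)) with htoZ
  have hZS : ∀ X ∈ 𝒳, toZ X ∈ S := fun X hX => ⟨X, hX, rfl⟩
  have hSC : ∀ Z ∈ S, ∀ i j, |Z i j| ≤ C := by
    rintro _ ⟨X, hX, rfl⟩ i j
    exact hC X hX i j
  classical
  set A : Finset (Fin n → Equiv.Perm (Fin m)) := Finset.univ.filter fun r =>
    ∃ Z ∈ S, K * (√m * Real.log m) * (entropyIntegral S).toReal
      < centredLogLik (toZ Xs) Z r - centredLogLik (toZ Xs) (toZ Xs) r with hA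
  have hbound : ∑ r ∈ A, rowsProb (toZ Xs) r ≤ ε :=
    sum_rowsProb_exceed_le hm (hZS Xs hXs) hε hSC hg A fun r hr => (Finset.mem_filter.1 hr).2
  have hpoint : ∀ r : Fin n → Equiv.Perm (Fin m),
      μ {ω | (fun i => R i ω) = r} = ENNReal.ofReal (rowsProb (toZ Xs) r) := by
    intro r
    have h1 := hind.measure_inter_preimage_eq_mul Finset.univ (sets := fun i => {r i})
      (fun i _ => MeasurableSpace.measurableSet_top)
    have h2 : {ω | (fun i => R i ω) = r} = ⋂ i ∈ Finset.univ, R i ⁻¹' {r i} := by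
      ext ω
      simp [funext_iff]
    rw [h2, h1, rowsProb, ENNReal.ofReal_prod_of_nonneg fun i _ => (Real.exp_pos _).le]
    refine Finset.prod_congr rfl fun i _ => ?_
    rw [← permProb_eq_exp_plLog hφ (Xs i), ← hlaw]
    rfl
  calc _ ≤ μ (⋃ r ∈ A, {ω | (fun i => R i ω) = r}) := by
        -- The estimator need not be measurable: almost surely its bad event lies in a finite union
        -- of events `R = r`.
        refine measure_mono_ae ?_
        filter_upwards [hhat] with ω hω hlt
        refine Set.mem_biUnion (x := fun i => R i ω) ?_ rfl
        refine Finset.mem_filter.2 ⟨Finset.mem_univ _, toZ (Xhat ω), hZS _ hω.1, ?_⟩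
        refine lt_of_lt_of_le ?_ (mul_avgKL_le hn hφ (hω.2 hXs) (toZ Xs) (toZ (Xhat ω)) rfl rfl)
        change _ < _ at hlt
        rw [← ENNReal.ofReal_toReal hg, ← ENNReal.ofReal_mul hrate.le,
          ENNReal.ofReal_lt_ofReal_iff_of_nonneg (by positivity)] at hlt
        calc _ = n * (K * (√(m : ℝ) * Real.log m / n) * (entropyIntegral S).toReal) := by
              field_simp
          _ < _ := mul_lt_mul_of_pos_left hlt hn0
    _ ≤ ∑ r ∈ A, μ {ω | (fun i => R i ω) = r} := measure_biUnion_finset_le _ _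
    _ = ENNReal.ofReal (∑ r ∈ A, rowsProb (toZ Xs) r) := by
        rw [ENNReal.ofReal_sum_of_nonneg fun r _ => (rowsProb_pos _ r).le]
        exact Finset.sum_congr rfl fun r _ => hpoint r
    _ ≤ ENNReal.ofReal ε := ENNReal.ofReal_le_ofReal hbound
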